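/- For $\rho\in\mathbb{R}$ let $M^3(\rho)$ denote the standard 3-dimensional space form of constant sectional curvature $\rho$: Euclidean space $\mathbb{R}^3$ if $\rho=0$, the round sphere $\mathbb{S}^3(\rho)$ of radius $1/\sqrt{\rho}$ in $\mathbb{R}^4$ if $\rho>0$, and hyperbolic space $\mathbb{H}^3(\rho)$ if $\rho<0$. Let $\nabla$ be its Levi-Civita connection and $R(X,Y)Z=\nabla_X\nabla_YZ-\nabla_Y\nabla_XZ-\nabla_{[X,Y]}Z$ its curvature tensor. Let $I\subset\mathbb{R}$ be an open interval, let $\gamma:I\to M^3(\rho)$ be a smooth curve parametrized by arc length, and put $T=\gamma'$. The curve $\gamma$ is a geodesic if $\nabla_TT=0$ on $I$, and it is triharmonic if $$\nabla_T^5T+R(\nabla_T^3T,T)T-R(\nabla_T^2T,\nabla_TT)T=0\quad\text{on } I.$$ It is a Frenet helix with constant curvature $\kappa_0\ge 0$ and constant torsion $\tau_0\in\mathbb{R}$ if there are smooth vector fields $N,B$ along $\gamma$ such that $\{T,N,B\}$ is orthonormal and $$\nabla_TT=\kappa_0N,\qquad \nabla_TN=-\kappa_0T+\tau_0B,\qquad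 \nabla_TB=-\tau_0N .$$ **Theorem.** Let $\gamma$ be a Frenet helix in $M^3(\rho)$ with constant curvature $\kappa_0$ and constant torsion $\tau_0$. If $\gamma$ is triharmonic, then either $\gamma$ is a geodesic, or $\rho>0$, so that $M^3(\rho)=\mathbb{S}^3(\rho)$, and $\tau_0^2\le\rho$ and $$\kappa_0^2=(\rho-\tau_0^2)\pm\sqrt{\rho\,(\rho-\tau_0^2)}$$ for one of the two signs. In particular, in the second case, if $\tau_0=0$, then $\kappa_0^2=2\rho$ and $\gamma$ lies on a circle of a totally geodesic sphere $\mathbb{S}^2(\rho)\subset\mathbb{S}^3(\rho)$. -/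

import Mathlib

open Set
open scoped ContDiff

noncomputable section

namespace TriharmonicCurves

/-- The ambient space `ℝ⁴` of the three standard models, with coordinates `x 0, x 1, x 2, x 3`. -/
abbrev Amb : Type := EuclideanSpace ℝ (Fin 4)

/-- The ambient bilinear form: the Euclidean one on `ℝ⁴` if `0 < ρ`, the Minkowski form
`- u₀v₀ + u₁v₁ + u₂v₂ + u₃v₃` if `ρ < 0`, and `u₁v₁ + u₂v₂ + u₃v₃` if `ρ = 0`. Restricted to the
tangent spaces of `spaceForm ρ` it is the Riemannian metric. -/
def pairing (ρ : ℝ) (u v : Amb) : ℝ :=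
  Real.sign ρ * (u 0 * v 0) + u 1 * v 1 + u 2 * v 2 + u 3 * v 3

/-- The 3-dimensional space form `M³(ρ)`: the round sphere `S³(ρ)` of radius `1 / √ρ` if `0 < ρ`,
hyperbolic space `H³(ρ)` (upper sheet of the hyperboloid in Minkowski space) if `ρ < 0`, and
Euclidean space `ℝ³`, realised as `{x ∈ ℝ⁴ | x 0 = 0}`, if `ρ = 0`. -/
def spaceForm (ρ : ℝ) : Set Amb :=
  {x | (0 < ρ → pairing ρ x x = 1 / ρ) ∧
       (ρ < 0 → pairing ρ x x = 1 / ρ ∧ 0 < x 0) ∧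
       (ρ = 0 → x 0 = 0)}

/-- `v` is tangent to `spaceForm ρ` at the point `x`. -/
def IsTangent (ρ : ℝ) (x v : Amb) : Prop :=
  (ρ ≠ 0 → pairing ρ x v = 0) ∧ (ρ = 0 → v 0 = 0)

/-- For `ρ ≠ 0` and `x ∈ spaceForm ρ`, where `pairing ρ x x = 1 / ρ`, this is the orthogonal
projection of `ℝ⁴` onto the tangent space at `x`. For `ρ = 0` it is the identity; there it will be
applied only to vectors that are tangent already. -/
def tanProj (ρ : ℝ) (x v : Amb) : Amb := v - (ρ * pairing ρ x v) • x

/-- The Levi-Civita connection `∇_X Y` of `spaceForm ρ`: the tangential part of the ambient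
directional derivative of `Y` along `X`, for vector fields that are tangent along
`spaceForm ρ`. -/
def nabla (ρ : ℝ) (X Y : Amb → Amb) (x : Amb) : Amb :=
  tanProj ρ x (fderiv ℝ Y x (X x))

/-- `∇_X ∇_Y Z - ∇_Y ∇_X Z - ∇_[X,Y] Z`. -/
def curvatureField (ρ : ℝ) (X Y Z : Amb → Amb) (x : Amb) : Amb :=
  nabla ρ X (nabla ρ Y Z) x - nabla ρ Y (nabla ρ X Z) x
    - nabla ρ (VectorField.lieBracket ℝ X Y) Z x

/-- The Riemann curvature tensor `R(u, v) w` of `spaceForm ρ` at `x`, for tangent vectors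
`u, v, w` at `x`: the value at `x` of `curvatureField` on the smooth tangent fields
`y ↦ tanProj ρ y u`, `y ↦ tanProj ρ y v`, `y ↦ tanProj ρ y w`, which extend `u, v, w`. (As the
curvature is tensorial, any other smooth tangent extensions give the same value.) -/
def curvature (ρ : ℝ) (x u v w : Amb) : Amb :=
  curvatureField ρ (fun y => tanProj ρ y u) (fun y => tanProj ρ y v) (fun y => tanProj ρ y w) x

/-- The covariant derivative `∇_T V` along the curve `γ` of a tangent field `V` along `γ`. -/
def covDeriv (ρ : ℝ) (γ V : ℝ → Amb) (s : ℝ) : Amb :=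
  tanProj ρ (γ s) (deriv V s)

/-- The iterated covariant derivative `∇_T^k T` of the velocity field `T = γ'`. -/
def covT (ρ : ℝ) (γ : ℝ → Amb) (k : ℕ) : ℝ → Amb :=
  (covDeriv ρ γ)^[k] (deriv γ)

/-- `γ` is a smooth curve in `spaceForm ρ`, parametrized by arc length on the open interval `I`. -/
structure IsArcLengthCurve (ρ : ℝ) (I : Set ℝ) (γ : ℝ → Amb) : Prop where
  isOpen : IsOpen I
  ordConnected : I.OrdConnected
  smooth : ContDiffOn ℝ ∞ γ I
  mem : ∀ s ∈ I, γ s ∈ spaceForm ρ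
  unit_speed : ∀ s ∈ I, pairing ρ (deriv γ s) (deriv γ s) = 1

/-- `∇_T T = 0`. -/
def IsGeodesic (ρ : ℝ) (I : Set ℝ) (γ : ℝ → Amb) : Prop :=
  ∀ s ∈ I, covT ρ γ 1 s = 0

/-- `∇_T⁵ T + R(∇_T³ T, T) T - R(∇_T² T, ∇_T T) T = 0`. -/
def IsTriharmonic (ρ : ℝ) (I : Set ℝ) (γ : ℝ → Amb) : Prop :=
  ∀ s ∈ I, covT ρ γ 5 s
    + curvature ρ (γ s) (covT ρ γ 3 s) (covT ρ γ 0 s) (covT ρ γ 0 s)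
    - curvature ρ (γ s) (covT ρ γ 2 s) (covT ρ γ 1 s) (covT ρ γ 0 s) = 0

/-- `T = γ'`, `N`, `B` is a smooth orthonormal frame along `γ` that satisfies the Frenet equations
with curvature `κ` and torsion `τ`. -/
structure IsFrenetFrame (ρ : ℝ) (I : Set ℝ) (γ N B : ℝ → Amb) (κ τ : ℝ → ℝ) : Prop where
  smooth_N : ContDiffOn ℝ ∞ N I
  smooth_B : ContDiffOn ℝ ∞ B I
  tangent_N : ∀ s ∈ I, IsTangent ρ (γ s) (N s)
  tangent_B : ∀ s ∈ I, IsTangent ρ (γ s) (B s)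
  NN : ∀ s ∈ I, pairing ρ (N s) (N s) = 1
  BB : ∀ s ∈ I, pairing ρ (B s) (B s) = 1
  TN : ∀ s ∈ I, pairing ρ (deriv γ s) (N s) = 0
  TB : ∀ s ∈ I, pairing ρ (deriv γ s) (B s) = 0
  NB : ∀ s ∈ I, pairing ρ (N s) (B s) = 0
  nabla_T : ∀ s ∈ I, covDeriv ρ γ (deriv γ) s = κ s • N s
  nabla_N : ∀ s ∈ I, covDeriv ρ γ N s = -(κ s) • deriv γ s + τ s • B s
  nabla_B : ∀ s ∈ I, covDeriv ρ γ B s = -(τ s) • N s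

/-- A Frenet helix with constant curvature `κ₀ = ‖∇_T T‖` and constant torsion `τ₀`. Geodesics are
the case `κ₀ = 0` (they carry a parallel orthonormal frame). -/
def IsFrenetHelix (ρ : ℝ) (I : Set ℝ) (γ : ℝ → Amb) (κ₀ τ₀ : ℝ) : Prop :=
  0 ≤ κ₀ ∧ ∃ N B : ℝ → Amb, IsFrenetFrame ρ I γ N B (fun _ => κ₀) (fun _ => τ₀)

/-- For `0 < ρ`, `S` is a totally geodesic sphere `S²(ρ)` in `S³(ρ)`: the intersection of
`S³(ρ)` with a hyperplane through the origin. -/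
def IsTotallyGeodesicSphere (ρ : ℝ) (S : Set Amb) : Prop :=
  ∃ n : Amb, n ≠ 0 ∧ S = {x | x ∈ spaceForm ρ ∧ pairing ρ n x = 0}

/-- For `0 < ρ` and a totally geodesic sphere `S` in `S³(ρ)`, the set `C` is a circle in `S`: the
set of the points of `S` at a fixed distance from a point `p` of `S`. The (chordal) distance lies
strictly between `0` and the diameter `2 / √ρ`, so that the circle is not a point. -/
def IsCircleIn (ρ : ℝ) (S C : Set Amb) : Prop :=
  ∃ p ∈ S, ∃ r : ℝ, 0 < r ∧ r < 2 / √ρ ∧ C = {x | x ∈ S ∧ dist x p = r}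

end TriharmonicCurves

end

/-! On a space form `R(u,v)w = ρ(⟨v,w⟩u - ⟨u,w⟩v)` (`curvature_eq`). For a helix the Frenet
equations make the fields `∇_T^k T` alternate between multiples of `N` (odd `k`) and combinations of
`T` and `B` (even `k`), so the tritension is `κ₀((κ₀² + τ₀²)² - ρ(2κ₀² + τ₀²)) N`
(`tritension_helix`). If `κ₀ ≠ 0` the bracket vanishes; this forces `ρ > 0`, and it is a quadratic
equation in `κ₀²` with the stated roots. If `τ₀ = 0`, both `B` and `N + κ₀γ` are constant in `ℝ⁴`:
the first is normal to the hyperplane of the sphere, the second points to the centre of the circle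
(`exists_circle_of_torsion_eq_zero`). -/

namespace TriharmonicCurves

/-! ### Bilinearity and derivatives of the ambient form. -/

section Pairing

variable (ρ : ℝ)

/-- `pairing ρ` as a continuous bilinear map. -/
noncomputable def pairingCLM : Amb →L[ℝ] Amb →L[ℝ] ℝ :=
  LinearMap.toContinuousLinearMap
    ((LinearMap.toContinuousLinearMap : (Amb →ₗ[ℝ] ℝ) ≃ₗ[ℝ] (Amb →L[ℝ] ℝ)).toLinearMap ∘ₗ
      LinearMap.mk₂ ℝ (pairing ρ)
        (by intros; simp [pairing]; ring) (by intros; simp [pairing]; ring)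
        (by intros; simp [pairing]; ring) (by intros; simp [pairing]; ring))

theorem pairingCLM_apply (u v : Amb) : pairingCLM ρ u v = pairing ρ u v := rfl

theorem pairing_comm (u v : Amb) : pairing ρ u v = pairing ρ v u := by
  simp [pairing]; ring

theorem pairing_add_left (u v w : Amb) :
    pairing ρ (u + v) w = pairing ρ u w + pairing ρ v w := by
  simp [pairing]; ring

theorem pairing_add_right (u v w : Amb) :
    pairing ρ u (v + w) = pairing ρ u v + pairing ρ u w := by
  simp [pairing]; ring

theorem pairing_sub_left (u v w : Amb) :
    pairing ρ (u - v) w = pairing ρ u w - pairing ρ v w := by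
  simp [pairing]; ring

theorem pairing_sub_right (u v w : Amb) :
    pairing ρ u (v - w) = pairing ρ u v - pairing ρ u w := by
  simp [pairing]; ring

theorem pairing_smul_left (a : ℝ) (u v : Amb) : pairing ρ (a • u) v = a * pairing ρ u v := by
  simp [pairing]; ring

theorem pairing_smul_right (a : ℝ) (u v : Amb) : pairing ρ u (a • v) = a * pairing ρ u v := by
  simp [pairing]; ring

theorem pairing_zero_left (v : Amb) : pairing ρ 0 v = 0 := by simp [pairing]

theorem pairing_zero_right (v : Amb) : pairing ρ v 0 = 0 := by simp [pairing]

variable {ρ}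

theorem pairing_self_of_pos (hρ : 0 < ρ) (u : Amb) : pairing ρ u u = ‖u‖ ^ 2 := by
  rw [EuclideanSpace.norm_sq_eq, Fin.sum_univ_four]
  simp [pairing, Real.sign_of_pos hρ]
  ring

theorem hasDerivAt_pairing {f g : ℝ → Amb} {f' g' : Amb} {s : ℝ} (hf : HasDerivAt f f' s)
    (hg : HasDerivAt g g' s) :
    HasDerivAt (fun t => pairing ρ (f t) (g t)) (pairing ρ (f s) g' + pairing ρ f' (g s)) s :=
  (pairingCLM ρ).hasDerivAt_of_bilinear (fun _ => hf) (fun _ => hg)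

theorem differentiableAt_pairing {f g : Amb → Amb} {x : Amb} (hf : DifferentiableAt ℝ f x)
    (hg : DifferentiableAt ℝ g x) : DifferentiableAt ℝ (fun y => pairing ρ (f y) (g y)) x :=
  ((pairingCLM ρ).hasFDerivAt_of_bilinear hf.hasFDerivAt hg.hasFDerivAt).differentiableAt

theorem fderiv_pairing {f g : Amb → Amb} {x : Amb} (hf : DifferentiableAt ℝ f x)
    (hg : DifferentiableAt ℝ g x) (h : Amb) :
    fderiv ℝ (fun y => pairing ρ (f y) (g y)) x h =
      pairing ρ (f x) (fderiv ℝ g x h) + pairing ρ (fderiv ℝ f x h) (g x) := by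
  have := ((pairingCLM ρ).hasFDerivAt_of_bilinear hf.hasFDerivAt hg.hasFDerivAt).fderiv
  have h2 := congrArg (fun L : Amb →L[ℝ] ℝ => L h) this
  simpa [pairingCLM_apply] using h2

end Pairing

/-! ### Constant curvature of the three models. -/

section Curvature

variable {ρ : ℝ}

theorem tanProj_add (x u v : Amb) : tanProj ρ x (u + v) = tanProj ρ x u + tanProj ρ x v := by
  simp only [tanProj, pairing_add_right]; module

theorem tanProj_smul (x : Amb) (a : ℝ) (u : Amb) :
    tanProj ρ x (a • u) = a • tanProj ρ x u := by
  simp only [tanProj, pairing_smul_right]; module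

theorem tanProj_of_tangent {x u : Amb} (h : ρ * pairing ρ x u = 0) : tanProj ρ x u = u := by
  simp [tanProj, h]

/-- The form of `hx` treats all models at once: it means `⟨x,x⟩ = 1/ρ` if `ρ ≠ 0` and is void if `ρ
= 0`. -/
theorem tanProj_rho_smul {x : Amb} (hx : ρ * (ρ * pairing ρ x x) = ρ) (a : ℝ) :
    tanProj ρ x ((ρ * a) • x) = 0 := by
  rw [tanProj, pairing_smul_right, ← sub_smul,
    show ρ * a - ρ * (ρ * a * pairing ρ x x) = 0 by linear_combination -a * hx, zero_smul]

theorem differentiableAt_tanProj {A : Amb → Amb} {x : Amb} (hA : DifferentiableAt ℝ A x) :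
    DifferentiableAt ℝ (fun y => tanProj ρ y (A y)) x :=
  hA.sub (((differentiableAt_pairing differentiableAt_fun_id hA).const_mul ρ).smul
    differentiableAt_fun_id)

theorem fderiv_tanProj {A : Amb → Amb} {x : Amb} (hA : DifferentiableAt ℝ A x) (h : Amb) :
    fderiv ℝ (fun y => tanProj ρ y (A y)) x h =
      fderiv ℝ A x h - (ρ * (pairing ρ x (fderiv ℝ A x h) + pairing ρ h (A x))) • x
        - (ρ * pairing ρ x (A x)) • h := by
  have hp : DifferentiableAt ℝ (fun y => pairing ρ y (A y)) x :=
    differentiableAt_pairing differentiableAt_fun_id hA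
  have h1 := (hA.hasFDerivAt.sub
    ((hp.hasFDerivAt.const_mul ρ).smul (hasFDerivAt_id x))).fderiv
  have h2 := congrArg (fun L : Amb →L[ℝ] Amb => L h) h1
  have h3 := fderiv_pairing (ρ := ρ) (f := fun y => y) differentiableAt_fun_id hA h
  simp only [fderiv_fun_id, ContinuousLinearMap.id_apply] at h3
  refine h2.trans ?_
  simp [h3]
  module

theorem fderiv_tanProj_const (x w h : Amb) :
    fderiv ℝ (fun y => tanProj ρ y w) x h =
      -((ρ * pairing ρ h w) • x) - (ρ * pairing ρ x w) • h := by
  rw [fderiv_tanProj (differentiableAt_const w)]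
  simp [pairing_zero_right]

/-- The covariant derivative of the tangent extension of `w` along that of `v`. -/
theorem nabla_tanProj (v w : Amb) :
    nabla ρ (fun y => tanProj ρ y v) (fun y => tanProj ρ y w) =
      fun y => tanProj ρ y
        (-((ρ * pairing ρ (tanProj ρ y v) w) • y) - (ρ * pairing ρ y w) • tanProj ρ y v) := by
  funext y
  simp only [nabla, fderiv_tanProj_const]

/-- Up to normal terms the inner derivative is `-ρ⟨y,w⟩V(y)`, whose coefficient vanishes at `x`;
hence only the derivative `ρ⟨u,w⟩` of that coefficient survives. -/
theorem nabla_nabla_tanProj {x u v w : Amb} (hx : ρ * (ρ * pairing ρ x x) = ρ)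
    (hu : ρ * pairing ρ x u = 0) (hv : ρ * pairing ρ x v = 0) (hw : ρ * pairing ρ x w = 0) :
    nabla ρ (fun y => tanProj ρ y u)
      (nabla ρ (fun y => tanProj ρ y v) (fun y => tanProj ρ y w)) x =
      -((ρ * pairing ρ u w) • v) := by
  have dV : DifferentiableAt ℝ (fun y => tanProj ρ y v) x :=
    differentiableAt_tanProj (differentiableAt_const v)
  have dVw : DifferentiableAt ℝ (fun y => pairing ρ (tanProj ρ y v) w) x :=
    differentiableAt_pairing dV (differentiableAt_const w)
  have dyw : DifferentiableAt ℝ (fun y => pairing ρ y w) x :=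
    differentiableAt_pairing differentiableAt_fun_id (differentiableAt_const w)
  have hyw := fderiv_pairing (ρ := ρ) (f := fun y => y) (g := fun _ => w) (x := x)
    differentiableAt_fun_id (differentiableAt_const w) u
  simp only [fderiv_fun_id, ContinuousLinearMap.id_apply, fderiv_fun_const, Pi.zero_apply,
    zero_apply, pairing_zero_right, zero_add] at hyw
  obtain ⟨A, hA⟩ : ∃ A : Amb → Amb, A = fun y =>
      -((ρ * pairing ρ (tanProj ρ y v) w) • y) - (ρ * pairing ρ y w) • tanProj ρ y v := ⟨_, rfl⟩
  have hAd := ((dVw.hasFDerivAt.const_mul ρ).smul (hasFDerivAt_id x)).neg.sub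
    ((dyw.hasFDerivAt.const_mul ρ).smul dV.hasFDerivAt)
  have dA : DifferentiableAt ℝ A x := hA ▸ hAd.differentiableAt
  have hA' : fderiv ℝ A x u =
      -((ρ * fderiv ℝ (fun y => pairing ρ (tanProj ρ y v) w) x u) • x)
        - (ρ * pairing ρ v w) • u - (ρ * pairing ρ u w) • v := by
    rw [hA]
    refine (congrArg (fun L : Amb →L[ℝ] Amb => L u) hAd.fderiv).trans ?_
    simp [hyw, hw, tanProj_of_tangent hv]
    module
  have hAx : A x = -((ρ * pairing ρ v w) • x) := by
    simp [hA, hw, tanProj_of_tangent hv]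
  have hxA : ρ * pairing ρ x (A x) = -(ρ * pairing ρ v w) := by
    rw [hAx, ← neg_smul, pairing_smul_right]
    linear_combination -pairing ρ v w * hx
  rw [show nabla ρ (fun y => tanProj ρ y v) (fun y => tanProj ρ y w) =
    fun y => tanProj ρ y (A y) by rw [nabla_tanProj, hA]]
  simp only [nabla, tanProj_of_tangent hu]
  rw [fderiv_tanProj dA, hxA]
  -- This scalar, like `a` below, only multiplies the normal vector `x`, which the projection kills,
  -- so its value is irrelevant.
  generalize pairing ρ x (fderiv ℝ A x u) + pairing ρ u (A x) = b
  rw [hA']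
  generalize fderiv ℝ (fun y => pairing ρ (tanProj ρ y v) w) x u = a
  have e : -((ρ * a) • x) - (ρ * pairing ρ v w) • u - (ρ * pairing ρ u w) • v - (ρ * b) • x
      - (-(ρ * pairing ρ v w)) • u = (ρ * (-a - b)) • x + (-(ρ * pairing ρ u w)) • v := by
    module
  rw [e, tanProj_add, tanProj_rho_smul hx, tanProj_smul, tanProj_of_tangent hv, zero_add, neg_smul]

/-- The space form `spaceForm ρ` has constant sectional curvature `ρ`. -/
theorem curvature_eq {x u v w : Amb} (hx : ρ * (ρ * pairing ρ x x) = ρ)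
    (hu : ρ * pairing ρ x u = 0) (hv : ρ * pairing ρ x v = 0) (hw : ρ * pairing ρ x w = 0) :
    curvature ρ x u v w = (ρ * pairing ρ v w) • u - (ρ * pairing ρ u w) • v := by
  -- At `x` the derivative of either extension along the other is `-ρ⟨u,v⟩x`, symmetric in `u` and
  -- `v`.
  have hb : VectorField.lieBracket ℝ (fun y => tanProj ρ y u) (fun y => tanProj ρ y v) x = 0 := by
    simp only [VectorField.lieBracket, fderiv_tanProj_const, tanProj_of_tangent hu,
      tanProj_of_tangent hv, hu, hv, pairing_comm ρ u v]
    simp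
  have h0 : nabla ρ (VectorField.lieBracket ℝ (fun y => tanProj ρ y u) (fun y => tanProj ρ y v))
      (fun y => tanProj ρ y w) x = 0 := by
    rw [nabla, hb, map_zero, tanProj, pairing_zero_right]
    simp
  rw [curvature, curvatureField, h0, nabla_nabla_tanProj hx hu hv hw,
    nabla_nabla_tanProj hx hv hu hw]
  module

end Curvature

/-! ### Covariant derivatives along curves. -/

section Curves

variable {ρ : ℝ} {I : Set ℝ} {γ : ℝ → Amb}

theorem rho_mul_pairing_of_mem {x : Amb} (hx : x ∈ spaceForm ρ) :
    ρ * (ρ * pairing ρ x x) = ρ := by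
  rcases lt_trichotomy ρ 0 with h | h | h
  · rw [(hx.2.1 h).1, mul_one_div_cancel h.ne, mul_one]
  · simp [h]
  · rw [hx.1 h, mul_one_div_cancel h.ne', mul_one]

theorem rho_mul_pairing_of_isTangent {x v : Amb} (h : IsTangent ρ x v) :
    ρ * pairing ρ x v = 0 := by
  rcases eq_or_ne ρ 0 with h0 | h0
  · simp [h0]
  · simp [h.1 h0]

theorem covDeriv_congr {V W : ℝ → Amb} (hI : IsOpen I) (h : EqOn V W I) {s : ℝ} (hs : s ∈ I) :
    covDeriv ρ γ V s = covDeriv ρ γ W s := by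
  rw [covDeriv, covDeriv, (h.eventuallyEq_of_mem (hI.mem_nhds hs)).deriv_eq]

theorem covDeriv_const_smul {V : ℝ → Amb} {s : ℝ} (a : ℝ) (hV : DifferentiableAt ℝ V s) :
    covDeriv ρ γ (fun t => a • V t) s = a • covDeriv ρ γ V s := by
  rw [covDeriv, covDeriv, ← tanProj_smul, deriv_fun_const_smul a hV]

theorem covDeriv_add {V W : ℝ → Amb} {s : ℝ} (hV : DifferentiableAt ℝ V s)
    (hW : DifferentiableAt ℝ W s) :
    covDeriv ρ γ (fun t => V t + W t) s = covDeriv ρ γ V s + covDeriv ρ γ W s := by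
  rw [covDeriv, covDeriv, covDeriv, ← tanProj_add, deriv_fun_add hV hW]

theorem IsArcLengthCurve.hasDerivAt (hγ : IsArcLengthCurve ρ I γ) {s : ℝ} (hs : s ∈ I) :
    HasDerivAt γ (deriv γ s) s :=
  ((hγ.smooth.contDiffAt (hγ.isOpen.mem_nhds hs)).differentiableAt (by simp)).hasDerivAt

theorem IsArcLengthCurve.differentiableAt_deriv (hγ : IsArcLengthCurve ρ I γ) {s : ℝ}
    (hs : s ∈ I) : DifferentiableAt ℝ (deriv γ) s :=
  ((hγ.smooth.deriv_of_isOpen (m := 1) hγ.isOpen (by norm_cast)).contDiffAt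
    (hγ.isOpen.mem_nhds hs)).differentiableAt (by simp)

/-- If the pairing of two fields is constant on `I`, the Leibniz rule for it holds with value
`0`. -/
theorem pairing_deriv_eq_zero {f g : ℝ → Amb} {f' g' : Amb} {c s : ℝ} (hI : IsOpen I)
    (h : ∀ t ∈ I, pairing ρ (f t) (g t) = c) (hs : s ∈ I) (hf : HasDerivAt f f' s)
    (hg : HasDerivAt g g' s) : pairing ρ (f s) g' + pairing ρ f' (g s) = 0 := by
  have h1 := hasDerivAt_pairing (ρ := ρ) hf hg
  have h2 : HasDerivAt (fun t => pairing ρ (f t) (g t)) 0 s :=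
    (hasDerivAt_const s c).congr_of_eventuallyEq
      (Filter.eventually_of_mem (hI.mem_nhds hs) h)
  exact h1.unique h2

theorem IsArcLengthCurve.tangent_deriv (hγ : IsArcLengthCurve ρ I γ) {s : ℝ} (hs : s ∈ I) :
    ρ * pairing ρ (γ s) (deriv γ s) = 0 := by
  rcases eq_or_ne ρ 0 with h0 | h0
  · simp [h0]
  have hc : ∀ t ∈ I, pairing ρ (γ t) (γ t) = 1 / ρ := fun t ht => by
    have := rho_mul_pairing_of_mem (hγ.mem t ht)
    field_simp at this ⊢
    linarith
  have := pairing_deriv_eq_zero hγ.isOpen hc hs (hγ.hasDerivAt hs) (hγ.hasDerivAt hs)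
  rw [pairing_comm ρ (deriv γ s)] at this
  rw [show pairing ρ (γ s) (deriv γ s) = 0 by linarith, mul_zero]

/-- Along a curve, the covariant derivative of a tangent field that is orthogonal to the velocity
is its ambient derivative. -/
theorem covDeriv_eq_deriv (hγ : IsArcLengthCurve ρ I γ) {V : ℝ → Amb}
    (hV : ∀ t ∈ I, IsTangent ρ (γ t) (V t)) (hT : ∀ t ∈ I, pairing ρ (deriv γ t) (V t) = 0)
    {s : ℝ} (hs : s ∈ I) (hd : DifferentiableAt ℝ V s) : covDeriv ρ γ V s = deriv V s := by
  rcases eq_or_ne ρ 0 with h0 | h0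
  · simp [covDeriv, tanProj, h0]
  have := pairing_deriv_eq_zero hγ.isOpen (fun t ht => (hV t ht).1 h0) hs (hγ.hasDerivAt hs)
    hd.hasDerivAt
  rw [hT s hs, add_zero] at this
  simp [covDeriv, tanProj, this]

theorem IsFrenetFrame.differentiableAt_N {N B : ℝ → Amb} {κ τ : ℝ → ℝ}
    (hF : IsFrenetFrame ρ I γ N B κ τ) (hI : IsOpen I) {s : ℝ} (hs : s ∈ I) :
    DifferentiableAt ℝ N s :=
  (hF.smooth_N.contDiffAt (hI.mem_nhds hs)).differentiableAt (by simp)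

theorem IsFrenetFrame.differentiableAt_B {N B : ℝ → Amb} {κ τ : ℝ → ℝ}
    (hF : IsFrenetFrame ρ I γ N B κ τ) (hI : IsOpen I) {s : ℝ} (hs : s ∈ I) :
    DifferentiableAt ℝ B s :=
  (hF.smooth_B.contDiffAt (hI.mem_nhds hs)).differentiableAt (by simp)

/-! ### Tritension of a helix, and the circle for zero torsion. -/

section Helix

variable {N B : ℝ → Amb} {κ₀ τ₀ : ℝ}

theorem covDeriv_smul_N (hγ : IsArcLengthCurve ρ I γ)
    (hF : IsFrenetFrame ρ I γ N B (fun _ => κ₀) (fun _ => τ₀)) {V : ℝ → Amb} {a : ℝ}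
    (hV : ∀ t ∈ I, V t = a • N t) {s : ℝ} (hs : s ∈ I) :
    covDeriv ρ γ V s = (-(a * κ₀)) • deriv γ s + (a * τ₀) • B s := by
  rw [covDeriv_congr hγ.isOpen hV hs, covDeriv_const_smul a (hF.differentiableAt_N hγ.isOpen hs),
    hF.nabla_N s hs]
  module

theorem covDeriv_smul_T_add_smul_B (hγ : IsArcLengthCurve ρ I γ)
    (hF : IsFrenetFrame ρ I γ N B (fun _ => κ₀) (fun _ => τ₀)) {V : ℝ → Amb} {a b : ℝ}
    (hV : ∀ t ∈ I, V t = a • deriv γ t + b • B t) {s : ℝ} (hs : s ∈ I) :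
    covDeriv ρ γ V s = (a * κ₀ - b * τ₀) • N s := by
  have hT := hγ.differentiableAt_deriv hs
  have hB := hF.differentiableAt_B hγ.isOpen hs
  rw [covDeriv_congr hγ.isOpen hV hs, covDeriv_add (hT.fun_const_smul a) (hB.fun_const_smul b),
    covDeriv_const_smul a hT, covDeriv_const_smul b hB, hF.nabla_T s hs, hF.nabla_B s hs]
  module

/-- The tritension field of a Frenet helix is a multiple of the principal normal. -/
theorem tritension_helix (hγ : IsArcLengthCurve ρ I γ)
    (hF : IsFrenetFrame ρ I γ N B (fun _ => κ₀) (fun _ => τ₀)) {s : ℝ} (hs : s ∈ I) :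
    covT ρ γ 5 s
      + curvature ρ (γ s) (covT ρ γ 3 s) (covT ρ γ 0 s) (covT ρ γ 0 s)
      - curvature ρ (γ s) (covT ρ γ 2 s) (covT ρ γ 1 s) (covT ρ γ 0 s) =
      (κ₀ * ((κ₀ ^ 2 + τ₀ ^ 2) ^ 2 - ρ * (2 * κ₀ ^ 2 + τ₀ ^ 2))) • N s := by
  have h0 : covT ρ γ 0 = deriv γ := rfl
  have h1 : ∀ t ∈ I, covT ρ γ 1 t = κ₀ • N t := hF.nabla_T
  -- The coefficients, left to unification, are passed from each derivative to the next.
  have h2 : ∀ t ∈ I, covT ρ γ 2 t = _ := fun t ht => covDeriv_smul_N hγ hF h1 ht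
  have h3 : ∀ t ∈ I, covT ρ γ 3 t = _ := fun t ht => covDeriv_smul_T_add_smul_B hγ hF h2 ht
  have h4 : ∀ t ∈ I, covT ρ γ 4 t = _ := fun t ht => covDeriv_smul_N hγ hF h3 ht
  have h5 : ∀ t ∈ I, covT ρ γ 5 t = _ := fun t ht => covDeriv_smul_T_add_smul_B hγ hF h4 ht
  have hx := rho_mul_pairing_of_mem (hγ.mem s hs)
  have hT := hγ.tangent_deriv hs
  have hN := rho_mul_pairing_of_isTangent (hF.tangent_N s hs)
  have hB := rho_mul_pairing_of_isTangent (hF.tangent_B s hs)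
  have hN' (a : ℝ) : ρ * pairing ρ (γ s) (a • N s) = 0 := by
    rw [pairing_smul_right]; linear_combination a * hN
  have hTB (a b : ℝ) : ρ * pairing ρ (γ s) (a • deriv γ s + b • B s) = 0 := by
    rw [pairing_add_right, pairing_smul_right, pairing_smul_right]
    linear_combination a * hT + b * hB
  rw [h0, h1 s hs, h2 s hs, h3 s hs, h5 s hs, curvature_eq hx (hN' _) hT hT,
    curvature_eq hx (hTB _ _) (hN' _) hT]
  simp only [pairing_add_left, pairing_smul_left, hγ.unit_speed s hs,
    pairing_comm ρ (N s) (deriv γ s), pairing_comm ρ (B s) (deriv γ s), hF.TN s hs, hF.TB s hs]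
  module

/-- The pairing of `γ` with the constant vector `c = N + κ₀γ` is constant, so `γ` keeps a fixed
chordal distance from the point of the sphere in direction `c`. -/
theorem exists_circle_of_torsion_eq_zero (hρ : 0 < ρ) (hI : I.Nonempty)
    (hγ : IsArcLengthCurve ρ I γ)
    (hF : IsFrenetFrame ρ I γ N B (fun _ => κ₀) (fun _ => 0)) :
    ∃ S C : Set Amb, IsTotallyGeodesicSphere ρ S ∧ IsCircleIn ρ S C ∧ γ '' I ⊆ C := by
  obtain ⟨s₀, hs₀⟩ := hI
  have hconv : Convex ℝ I := hγ.ordConnected.convex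
  have hdN : ∀ s ∈ I, HasDerivAt N (-κ₀ • deriv γ s) s := fun s hs => by
    have hd := hF.differentiableAt_N hγ.isOpen hs
    have h := covDeriv_eq_deriv hγ hF.tangent_N hF.TN hs hd
    rw [hF.nabla_N s hs, zero_smul, add_zero] at h
    exact h ▸ hd.hasDerivAt
  have hdB : ∀ s ∈ I, HasDerivAt B 0 s := fun s hs => by
    have hd := hF.differentiableAt_B hγ.isOpen hs
    have h := covDeriv_eq_deriv hγ hF.tangent_B hF.TB hs hd
    rw [hF.nabla_B s hs, neg_zero, zero_smul] at h
    exact h ▸ hd.hasDerivAt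
  have hdc : ∀ s ∈ I, HasDerivAt (fun t => N t + κ₀ • γ t) 0 s := fun s hs => by
    have := (hdN s hs).add ((hγ.hasDerivAt hs).const_smul κ₀)
    rwa [← add_smul, neg_add_cancel, zero_smul] at this
  have hconst : ∀ f : ℝ → Amb, (∀ s ∈ I, HasDerivAt f 0 s) → ∀ s ∈ I, f s = f s₀ :=
    fun f hf s hs => by
      have := hconv.norm_image_sub_le_of_norm_hasDerivWithin_le (C := 0)
        (fun t ht => (hf t ht).hasDerivWithinAt) (by simp) hs₀ hs
      rw [zero_mul] at this
      exact sub_eq_zero.1 (norm_le_zero_iff.1 this)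
  have hBc := hconst B hdB
  have hcc := hconst _ hdc
  set n := B s₀ with hn
  set c := N s₀ + κ₀ • γ s₀ with hc
  have hγγ : ∀ s ∈ I, pairing ρ (γ s) (γ s) = 1 / ρ := fun s hs => (hγ.mem s hs).1 hρ
  have hγN : ∀ s ∈ I, pairing ρ (γ s) (N s) = 0 := fun s hs => (hF.tangent_N s hs).1 hρ.ne'
  have hγB : ∀ s ∈ I, pairing ρ (γ s) (B s) = 0 := fun s hs => (hF.tangent_B s hs).1 hρ.ne'
  have hcc2 : pairing ρ c c = 1 + κ₀ ^ 2 / ρ := by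
    simp only [hc, pairing_add_left, pairing_add_right, pairing_smul_left, pairing_smul_right,
      pairing_comm ρ (N s₀) (γ s₀), hγγ s₀ hs₀, hγN s₀ hs₀, hF.NN s₀ hs₀]
    ring
  have hnc : pairing ρ n c = 0 := by
    simp only [hc, hn, pairing_add_right, pairing_smul_right, pairing_comm ρ (B s₀) (N s₀),
      pairing_comm ρ (B s₀) (γ s₀), hγB s₀ hs₀, hF.NB s₀ hs₀]
    ring
  have hγc : ∀ s ∈ I, pairing ρ (γ s) c = κ₀ / ρ := fun s hs => by
    rw [← hcc s hs, pairing_add_right, pairing_smul_right, hγγ s hs, hγN s hs]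
    ring
  have hL : 0 < ρ + κ₀ ^ 2 := by positivity
  -- Since `⟨c,c⟩ = (ρ + κ₀²)/ρ`, this factor scales `c` to length `1/√ρ`.
  set l := 1 / √(ρ + κ₀ ^ 2) with hl
  have hl2 : l ^ 2 = 1 / (ρ + κ₀ ^ 2) := by rw [hl, div_pow, Real.sq_sqrt hL.le, one_pow]
  -- The squared chordal distance `⟨γ,γ⟩ + ⟨lc,lc⟩ - 2l⟨γ,c⟩`; `|lκ₀| < 1` puts it strictly between
  -- `0` and `4/ρ`.
  set q := 2 / ρ - 2 * l * (κ₀ / ρ) with hq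
  have hlκ : (l * κ₀) ^ 2 < 1 := by
    rw [mul_pow, hl2, one_div_mul_eq_div, div_lt_one hL]; linarith
  have hlκ' := abs_lt.1 ((sq_lt_one_iff_abs_lt_one _).1 hlκ)
  have hq' : q = 2 * (1 - l * κ₀) / ρ := by rw [hq]; ring
  have hq0 : 0 < q := by rw [hq']; exact div_pos (by linarith) hρ
  have hq4 : q < 4 / ρ := by rw [hq']; gcongr; linarith
  have hpp : pairing ρ (l • c) (l • c) = 1 / ρ := by
    rw [pairing_smul_left, pairing_smul_right, hcc2, ← mul_assoc, ← sq, hl2]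
    field_simp
  refine ⟨{x | x ∈ spaceForm ρ ∧ pairing ρ n x = 0}, _, ⟨n, ?_, rfl⟩,
    ⟨l • c, ⟨⟨fun _ => hpp, fun h => absurd h hρ.not_gt, fun h => absurd h hρ.ne'⟩, ?_⟩,
      √q, Real.sqrt_pos.2 hq0, ?_, rfl⟩, ?_⟩
  · intro h
    have := hF.BB s₀ hs₀
    rw [← hn, h, pairing_zero_left] at this
    exact zero_ne_one this
  · rw [pairing_smul_right, hnc, mul_zero]
  · rw [show (2 : ℝ) / √ρ = √(4 / ρ) by
      rw [Real.sqrt_div (by norm_num), show (4 : ℝ) = 2 ^ 2 by norm_num,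
        Real.sqrt_sq (by norm_num)]]
    exact Real.sqrt_lt_sqrt hq0.le hq4
  · rintro _ ⟨s, hs, rfl⟩
    refine ⟨⟨hγ.mem s hs, ?_⟩, ?_⟩
    · rw [← hBc s hs, pairing_comm, hγB s hs]
    · rw [dist_eq_norm, ← Real.sqrt_sq (norm_nonneg _), ← pairing_self_of_pos hρ,
        pairing_sub_left, pairing_sub_right, pairing_sub_right, hpp, hγγ s hs,
        pairing_comm ρ (l • c), pairing_smul_right, hγc s hs, hq]
      congr 1
      ring

end Helix

theorem spaceForm_eq_sphere (hρ : 0 < ρ) : spaceForm ρ = Metric.sphere 0 (1 / √ρ) := by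
  ext x
  rw [mem_sphere_zero_iff_norm, ← sq_eq_sq₀ (norm_nonneg _) (by positivity), div_pow,
    Real.sq_sqrt hρ.le, one_pow, ← pairing_self_of_pos hρ]
  exact ⟨fun h => h.1 hρ, fun h =>
    ⟨fun _ => h, fun h' => absurd h' hρ.not_gt, fun h' => absurd h' hρ.ne'⟩⟩

end Curves

end TriharmonicCurves

/-! ### The equation for `κ₀²`. -/

theorem mainTheorem6 (ρ : ℝ) (I : Set ℝ) (γ : ℝ → TriharmonicCurves.Amb) (κ₀ τ₀ : ℝ)
    (hγ : TriharmonicCurves.IsArcLengthCurve ρ I γ)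
    (hhelix : TriharmonicCurves.IsFrenetHelix ρ I γ κ₀ τ₀)
    (htri : TriharmonicCurves.IsTriharmonic ρ I γ) :
    TriharmonicCurves.IsGeodesic ρ I γ ∨
      (0 < ρ ∧ TriharmonicCurves.spaceForm ρ = Metric.sphere 0 (1 / √ρ) ∧
        τ₀ ^ 2 ≤ ρ ∧
        (κ₀ ^ 2 = (ρ - τ₀ ^ 2) + √(ρ * (ρ - τ₀ ^ 2)) ∨
          κ₀ ^ 2 = (ρ - τ₀ ^ 2) - √(ρ * (ρ - τ₀ ^ 2))) ∧
        (τ₀ = 0 →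
          (∃ S C : Set TriharmonicCurves.Amb, TriharmonicCurves.IsTotallyGeodesicSphere ρ S ∧
            TriharmonicCurves.IsCircleIn ρ S C ∧ γ '' I ⊆ C) ∧
          κ₀ ^ 2 = 2 * ρ)) := by
  obtain ⟨-, N, B, hF⟩ := hhelix
  rcases eq_or_ne κ₀ 0 with hκ | hκ
  · left
    intro s hs
    exact (hF.nabla_T s hs).trans (by rw [hκ, zero_smul])
  rcases I.eq_empty_or_nonempty with hI | hI
  · left
    intro s hs
    simp [hI] at hs
  right
  obtain ⟨s, hs⟩ := id hI
  have hE : (κ₀ ^ 2 + τ₀ ^ 2) ^ 2 - ρ * (2 * κ₀ ^ 2 + τ₀ ^ 2) = 0 := by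
    have h := TriharmonicCurves.tritension_helix hγ hF hs
    rw [htri s hs] at h
    have h2 := congrArg (fun v => TriharmonicCurves.pairing ρ v (N s)) h
    simp only [TriharmonicCurves.pairing_zero_left, TriharmonicCurves.pairing_smul_left, hF.NN s hs, mul_one] at h2
    exact (mul_eq_zero.1 h2.symm).resolve_left hκ
  have hκ2 : 0 < κ₀ ^ 2 := by positivity
  have hρ : 0 < ρ := by
    have h1 : 0 < ρ * (2 * κ₀ ^ 2 + τ₀ ^ 2) := by
      rw [← sub_eq_zero.1 hE]; positivity
    exact pos_of_mul_pos_left h1 (by positivity)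
  -- Completing the square in `κ₀²`; nonnegativity of the left side also yields `τ₀² ≤ ρ`.
  have hsq : (κ₀ ^ 2 - (ρ - τ₀ ^ 2)) ^ 2 = ρ * (ρ - τ₀ ^ 2) := by linear_combination hE
  have hD : 0 ≤ ρ * (ρ - τ₀ ^ 2) := hsq ▸ sq_nonneg _
  refine ⟨hρ, TriharmonicCurves.spaceForm_eq_sphere hρ, ?_, ?_, ?_⟩
  · linarith [nonneg_of_mul_nonneg_right hD hρ]
  · rw [← Real.sq_sqrt hD] at hsq
    rcases sq_eq_sq_iff_eq_or_eq_neg.1 hsq with h | h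
    · left; linarith
    · right; linarith
  · rintro rfl
    refine ⟨TriharmonicCurves.exists_circle_of_torsion_eq_zero hρ hI hγ hF, ?_⟩
    have : κ₀ ^ 2 * (κ₀ ^ 2 - 2 * ρ) = 0 := by linear_combination hE
    linarith [(mul_eq_zero.1 this).resolve_left hκ2.ne']
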